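/- Let $v_1,\dots,v_n$ be real variables, each restricted to a nonempty compact interval $\mathrm{range}(v_i)\subset\mathbb R$; literals are the elements of $\{\pm v_1,\dots,\pm v_n\}$, and $\mathrm{range}(-v_i)=-\mathrm{range}(v_i)$. A continuous formula $\Gamma$ is a finite set of constraints $x\le f(y)$ with $x,y$ literals and $f:\mathbb R\to\mathbb R$ a continuous strictly increasing bijection; it is satisfiable if some choice of values $v_i\in\mathrm{range}(v_i)$ satisfies all constraints. It is symmetric if, with each constraint $x\le f(y)$, it also contains the equivalent constraint $-y\le\widetilde f(-x)$, where $\widetilde f(c)=-f^{-1}(-c)$. Let $H(\Gamma)$ be obtained from $\Gamma$ by first adding $x\le f(g(z))$ for every pair of constraints $x\le f(y)$, $y\le g(z)$ of $\Gamma$ with $y\ne x$ and $y\neq z$, and then, for each pair of literals $x,y$ with at least one constraint from $x$ to $y$, replacing all constraints $x\le f_i(y)$ by the single constraint $x\le(\min_i f_i)(y)$. For a continuous strictly increasing bijection $f$ of $\mathbb R$ and $x\in\mathbb R$ put $$f^\infty(x)=\inf\bigl\{y\in\mathbb R : y\ge \sup\{z\in\mathbb R: z\le x,\ z\le f(z)\},\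 y>f(y)\bigr\}\in\mathbb R\cup\{\pm\infty\},$$ with $\inf\emptyset=+\infty$ and $\sup\emptyset=-\infty$. Let $V(\Gamma)$ be obtained from $H^{\lceil\log_2 n+1\rceil}(\Gamma)$ by replacing each loop $x\le f(x)$ by $x\le f^\infty(x)$; all functions are extended to $\mathbb R\cup\{\pm\infty\}$ by fixing $\pm\infty$. A path from $x$ to $y$ in $V(\Gamma)$ is a nonempty list of constraints $x=x_1\le f_1(x_2),\dots,x_k\le f_k(x_{k+1})$ of $V(\Gamma)$ with $x_{k+1}=y$; it is tight if loops and constraints that are not loops alternate along it. Let $\min_{x\to y}(c)$ be the infimum of $(f_1\circ\dots\circ f_k)(c)$ over all tight paths from $x$ to $y$ in $V(\Gamma)$ ($+\infty$ if there are none). Then a symmetric continuous formula $\Gamma$ is satisfiable if and only if neither of the following happens: 1. There are literals $x$ and $y$ with $\min_{x\to y}(\max\mathrm{range}(y))<\min\mathrm{range}(x)$. 2. There are a literal $x$ and a $c\in\mathrm{range}(x)$ with $\min_{x\to -x}(-c)<c$ and $\min_{-x\to x}(c)<-c$. -/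

import Mathlib

namespace ContinuousTwoSAT

/-- The literals `v_i` (`pos i`) and `-v_i` (`neg i`) over the variables `v_1, …, v_n`. -/
inductive Literal (n : ℕ) : Type
  | pos (i : Fin n) : Literal n
  | neg (i : Fin n) : Literal n

instance {n : ℕ} : Neg (Literal n) where
  neg x := match x with
    | .pos i => .neg i
    | .neg i => .pos i

/-- The real value of a literal under an assignment of the variables. -/
def Literal.val {n : ℕ} (a : Fin n → ℝ) : Literal n → ℝ
  | .pos i => a i
  | .neg i => -a i

/-- The constraint `lhs ≤ fn rhs`. The order isomorphisms `ℝ ≃o ℝ` are exactly the strictly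
increasing bijections of `ℝ`, and these are automatically continuous. -/
structure Constraint (n : ℕ) where
  lhs : Literal n
  rhs : Literal n
  fn : ℝ ≃o ℝ

/-- `f ↦ f̃`, where `f̃ c = -f⁻¹(-c)`. -/
def dual (f : ℝ ≃o ℝ) : ℝ ≃o ℝ where
  toFun c := -f.symm (-c)
  invFun c := -f (-c)
  left_inv c := by simp
  right_inv c := by simp
  map_rel_iff' := by
    intro a b
    change -f.symm (-a) ≤ -f.symm (-b) ↔ a ≤ b
    rw [neg_le_neg_iff, f.symm.le_iff_le, neg_le_neg_iff]

/-- The pointwise minimum of a nonempty finite set of increasing bijections of `ℝ`, which is again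
an increasing bijection. -/
noncomputable def minIso (S : Finset (ℝ ≃o ℝ)) (hS : S.Nonempty) : ℝ ≃o ℝ where
  toFun c := S.inf' hS (fun f => f c)
  invFun c := S.sup' hS (fun f => f.symm c)
  left_inv c := by
    apply le_antisymm
    · refine Finset.sup'_le _ _ fun f hf => ?_
      rw [← f.le_iff_le, f.apply_symm_apply]
      exact Finset.inf'_le (fun f : ℝ ≃o ℝ => f c) hf
    · obtain ⟨f, hf, h⟩ := Finset.exists_mem_eq_inf' hS (fun f : ℝ ≃o ℝ => f c)
      calc c = f.symm (S.inf' hS (fun f => f c)) := by rw [h, f.symm_apply_apply]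
        _ ≤ _ := Finset.le_sup' (fun g : ℝ ≃o ℝ => g.symm (S.inf' hS (fun f => f c))) hf
  right_inv c := by
    apply le_antisymm
    · obtain ⟨f, hf, h⟩ := Finset.exists_mem_eq_sup' hS (fun f : ℝ ≃o ℝ => f.symm c)
      calc _ ≤ f (S.sup' hS (fun f => f.symm c)) :=
            Finset.inf'_le (fun g : ℝ ≃o ℝ => g (S.sup' hS (fun f => f.symm c))) hf
        _ = c := by rw [h, f.apply_symm_apply]
    · refine Finset.le_inf' _ _ fun f hf => ?_
      rw [← f.symm.le_iff_le, f.symm_apply_apply]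
      exact Finset.le_sup' (fun f : ℝ ≃o ℝ => f.symm c) hf
  map_rel_iff' := by
    intro a b
    have hmono : StrictMono fun c : ℝ => S.inf' hS (fun f : ℝ ≃o ℝ => f c) := by
      intro a b hab
      refine (Finset.lt_inf'_iff hS).2 fun f hf => ?_
      exact (Finset.inf'_le (fun f : ℝ ≃o ℝ => f a) hf).trans_lt (f.strictMono hab)
    exact hmono.le_iff_le

/-- A continuous formula in `n` real variables: a (nonempty) compact interval `[lo i, hi i]` for each
variable `v_i`, and finitely many constraints. -/
structure ContinuousFormula (n : ℕ) where
  lo : Fin n → ℝ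
  hi : Fin n → ℝ
  lo_le_hi : ∀ i, lo i ≤ hi i
  constraints : Finset (Constraint n)

/-- A constraint between extended-real-valued literals, used for formulas with infinite
compositions. -/
structure ExtConstraint (n : ℕ) where
  lhs : Literal n
  rhs : Literal n
  fn : EReal → EReal

/-- `f^∞ x = inf {y ≥ sup {z ≤ x : z ≤ f z} : y > f y}`, where `y` and `z` range over `ℝ`, and the
supremum and infimum are taken in `ℝ ∪ {±∞}` (so `sup ∅ = -∞` and `inf ∅ = +∞`). -/
noncomputable def infComp (f : ℝ → ℝ) (x : ℝ) : EReal :=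
  sInf ((fun y : ℝ => (y : EReal)) ''
    {y : ℝ | sSup ((fun z : ℝ => (z : EReal)) '' {z : ℝ | z ≤ x ∧ z ≤ f z}) ≤ (y : EReal) ∧ f y < y})

/-- The extension of `g : ℝ → ℝ ∪ {±∞}` to `ℝ ∪ {±∞}` that fixes `-∞` and `+∞`. -/
noncomputable def extend (g : ℝ → EReal) (x : EReal) : EReal :=
  EReal.rec (motive := fun _ => EReal) ⊥ g ⊤ x

namespace ExtConstraint

/-- `[e₁, …, e_k]` is a path from `x` to `y` with constraints in `V`: a nonempty list of constraints
`x = x₁ ≤ f₁(x₂), …, x_k ≤ f_k(x_{k+1} = y)`. -/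
inductive IsPath {n : ℕ} (V : Set (ExtConstraint n)) :
    Literal n → Literal n → List (ExtConstraint n) → Prop
  | single (e : ExtConstraint n) (he : e ∈ V) : IsPath V e.lhs e.rhs [e]
  | cons (e : ExtConstraint n) (he : e ∈ V) (y : Literal n) (p : List (ExtConstraint n))
      (hp : IsPath V e.rhs y p) : IsPath V e.lhs y (e :: p)

/-- A path is tight if it alternates between loops and constraints that are not loops. -/
def IsTight {n : ℕ} (p : List (ExtConstraint n)) : Prop :=
  List.IsChain (fun e e' => e.lhs = e.rhs ↔ ¬ e'.lhs = e'.rhs) p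

/-- `(f₁ ∘ ⋯ ∘ f_k) c` for a path `[e₁, …, e_k]` with functions `f₁, …, f_k`. -/
def eval {n : ℕ} (p : List (ExtConstraint n)) (c : EReal) : EReal :=
  p.foldr (fun e d => e.fn d) c

end ExtConstraint

namespace ContinuousFormula

variable {n : ℕ} (Γ : ContinuousFormula n)

/-- `min (range x)`, where `range (-v_i) = -range (v_i)`. -/
def rangeMin : Literal n → ℝ
  | .pos i => Γ.lo i
  | .neg i => -Γ.hi i

/-- `max (range x)`. -/
def rangeMax : Literal n → ℝ
  | .pos i => Γ.hi i
  | .neg i => -Γ.lo i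

/-- The range of a literal. -/
def range (x : Literal n) : Set ℝ := Set.Icc (Γ.rangeMin x) (Γ.rangeMax x)

/-- Some assignment of values `v_i ∈ range v_i` satisfies every constraint. -/
def Satisfiable : Prop :=
  ∃ a : Fin n → ℝ, (∀ i, a i ∈ Set.Icc (Γ.lo i) (Γ.hi i)) ∧
    ∀ C ∈ Γ.constraints, C.lhs.val a ≤ C.fn (C.rhs.val a)

/-- With every constraint `x ≤ f(y)` the formula contains the equivalent one `-y ≤ f̃(-x)`. -/
def IsSymmetric : Prop :=
  ∀ C ∈ Γ.constraints, (⟨-C.rhs, -C.lhs, dual C.fn⟩ : Constraint n) ∈ Γ.constraints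

open Classical in
/-- Add `x ≤ f(g(z))` for all constraints `x ≤ f(y)`, `y ≤ g(z)` with `y ≠ x` and `y ≠ z`. -/
noncomputable def addCompositions (K : Finset (Constraint n)) : Finset (Constraint n) :=
  K ∪ ((K ×ˢ K).filter
      (fun p => p.1.rhs = p.2.lhs ∧ p.1.rhs ≠ p.1.lhs ∧ p.1.rhs ≠ p.2.rhs)).image
    (fun p => ⟨p.1.lhs, p.2.rhs, p.2.fn.trans p.1.fn⟩)

open Classical in
/-- The functions `f` with `x ≤ f(y)` in `K`. -/
noncomputable def functionsBetween (K : Finset (Constraint n)) (x y : Literal n) :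
    Finset (ℝ ≃o ℝ) :=
  (K.filter (fun C => C.lhs = x ∧ C.rhs = y)).image Constraint.fn

theorem functionsBetween_nonempty (K : Finset (Constraint n)) (C : Constraint n) (hC : C ∈ K) :
    (functionsBetween K C.lhs C.rhs).Nonempty := by
  classical
  exact ⟨C.fn, by simpa [functionsBetween] using ⟨C, ⟨hC, rfl, rfl⟩, rfl⟩⟩

/-- The constraint `x ≤ min_i f_i(y)`, where `x` and `y` are the literals of `C ∈ K` and the `f_i` are
all the functions with `x ≤ f_i(y)` in `K`. -/
noncomputable def minOfParallel (K : Finset (Constraint n)) (C : Constraint n) (hC : C ∈ K) :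
    Constraint n where
  lhs := C.lhs
  rhs := C.rhs
  fn := minIso (functionsBetween K C.lhs C.rhs) (functionsBetween_nonempty K C hC)

open Classical in
/-- For all literals `x` and `y`, replace the constraints from `x` to `y` by their minimum. -/
noncomputable def mergeParallel (K : Finset (Constraint n)) : Finset (Constraint n) :=
  K.attach.image (fun C : {C : Constraint n // C ∈ K} => minOfParallel K C.1 C.2)

/-- The formula `H(Γ)`. -/
noncomputable def H : ContinuousFormula n :=
  { Γ with constraints := mergeParallel (addCompositions Γ.constraints) }

open Classical in
/-- The constraints of `V(Γ)`: those of `H^⌈log₂ n + 1⌉(Γ)`, with `x ≤ f(x)` replaced by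
`x ≤ f^∞(x)`, all functions being extended to `ℝ ∪ {±∞}` by fixing `±∞`. -/
noncomputable def V : Set (ExtConstraint n) :=
  (fun C : Constraint n =>
      (⟨C.lhs, C.rhs,
        if C.lhs = C.rhs then extend (infComp C.fn) else extend (fun c => (C.fn c : EReal))⟩ :
        ExtConstraint n)) ''
    {C | C ∈ (H^[⌈Real.logb 2 (n : ℝ) + 1⌉₊] Γ).constraints}

/-- `min_{x → y}(c)`: the infimum of `p(c)` over the tight paths `p` from `x` to `y` in `V(Γ)`
(`+∞` if there is none). -/
noncomputable def minTight (x y : Literal n) (c : ℝ) : EReal :=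
  sInf {v : EReal | ∃ p : List (ExtConstraint n),
    ExtConstraint.IsPath Γ.V x y p ∧ ExtConstraint.IsTight p ∧ v = ExtConstraint.eval p (c : EReal)}

end ContinuousFormula

end ContinuousTwoSAT

/-!
The constraints along a walk of `Γ` compose to a consequence `x ≤ f(y)` of `Γ`, and `min_{x → y}` is
a lower bound for all consequences obtained in this way: built up from its end, a walk reduces to a
tight path of `V(Γ)` without increase of its value. As soon as a literal repeats, the cycle between
its two occurrences is simple; if one turn does not decrease the value, the cycle is dropped, and
otherwise it is replaced by the loop `f^∞`, which decreases the value at least as much. Simple paths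
and simple cycles have length at most `2n`, so that doubling the length `⌈log₂ n⌉ + 1` times turns
them into single constraints.

If neither obstruction occurs, values are assigned to one literal at a time. First all upper bounds
are lowered as far as the consequences of `Γ` demand; then `x` receives the largest value `c`
satisfying all consequences `x ≤ f(-x)`. The consequences `-x ≤ g(x)` also hold at `c`: otherwise
one of them would still fail slightly above `c`, where some `x ≤ f(-x)` fails too, and this is the
second obstruction.
-/

namespace ContinuousTwoSAT

open ExtConstraint ContinuousFormula

variable {n : ℕ}

namespace Literal

instance : InvolutiveNeg (Literal n) where
  neg_neg x := by cases x <;> rfl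

theorem neg_ne_self (x : Literal n) : -x ≠ x := by
  cases x <;> rintro ⟨⟩

theorem val_neg (a : Fin n → ℝ) (x : Literal n) : (-x).val a = -x.val a := by
  cases x
  · rfl
  · exact (neg_neg _).symm

/-- A literal is a variable together with a sign. -/
def equivSum : Literal n ≃ Fin n ⊕ Fin n where
  toFun
    | pos i => .inl i
    | neg i => .inr i
  invFun
    | .inl i => pos i
    | .inr i => neg i
  left_inv x := by cases x <;> rfl
  right_inv x := by cases x <;> rfl

instance : Fintype (Literal n) := Fintype.ofEquiv _ equivSum.symm

theorem card_eq_two_mul : Fintype.card (Literal n) = 2 * n := by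
  rw [Fintype.card_congr equivSum, Fintype.card_sum, Fintype.card_fin, two_mul]

end Literal

/-! ### Dual functions, extensions and infinite compositions -/

theorem le_dual_apply_iff (f : ℝ ≃o ℝ) {a b : ℝ} : a ≤ dual f b ↔ -b ≤ f (-a) := by
  rw [← f.symm_apply_le]
  exact le_neg

theorem dual_refl : dual (OrderIso.refl ℝ) = OrderIso.refl ℝ := by
  ext c
  exact neg_neg c

theorem dual_trans (f g : ℝ ≃o ℝ) : dual (g.trans f) = (dual f).trans (dual g) := by
  ext c
  exact congrArg (fun t => -g.symm t) (neg_neg (f.symm (-c))).symm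

theorem monotone_extend {g : ℝ → EReal} (hg : Monotone g) : Monotone (extend g) := by
  intro a b hab
  induction a with
  | bot => exact bot_le
  | top => rw [top_le_iff.1 hab]
  | coe a =>
    induction b with
    | bot => exact absurd hab (EReal.bot_lt_coe a).not_ge
    | top => exact le_top
    | coe b => exact hg (EReal.coe_le_coe_iff.1 hab)

/-- The extension of an increasing bijection of `ℝ` to `ℝ ∪ {±∞}`. -/
noncomputable def extendIso (f : ℝ ≃o ℝ) : EReal → EReal := extend fun c => (f c : EReal)

theorem monotone_extendIso (f : ℝ ≃o ℝ) : Monotone (extendIso f) :=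
  monotone_extend fun _ _ h => EReal.coe_le_coe_iff.2 (f.monotone h)

theorem extendIso_le_extendIso {f g : ℝ ≃o ℝ} (h : ⇑f ≤ g) : extendIso f ≤ extendIso g := by
  intro d
  induction d with
  | bot | top => exact le_rfl
  | coe d => exact EReal.coe_le_coe_iff.2 (h d)

theorem extendIso_refl (d : EReal) : extendIso (OrderIso.refl ℝ) d = d := by
  induction d <;> rfl

theorem extendIso_trans (f g : ℝ ≃o ℝ) (d : EReal) :
    extendIso (g.trans f) d = extendIso f (extendIso g d) := by
  induction d <;> rfl

theorem monotone_infComp (f : ℝ → ℝ) : Monotone (infComp f) := by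
  intro a b hab
  refine sInf_le_sInf (Set.image_mono fun y hy => ⟨le_trans ?_ hy.1, hy.2⟩)
  exact sSup_le_sSup (Set.image_mono fun z hz => ⟨hz.1.trans hab, hz.2⟩)

theorem monotone_extend_infComp (f : ℝ → ℝ) : Monotone (extend (infComp f)) :=
  monotone_extend (monotone_infComp f)

theorem le_infComp {f : ℝ → ℝ} {x z : ℝ} (hzx : z ≤ x) (hz : z ≤ f z) :
    (z : EReal) ≤ infComp f x := by
  refine le_sInf ?_
  rintro _ ⟨y, hy, rfl⟩
  refine (le_sSup ?_).trans hy.1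
  exact ⟨z, ⟨hzx, hz⟩, rfl⟩

theorem infComp_le_apply {f : ℝ → ℝ} (hf : StrictMono f) {x : ℝ} (hx : f x < x) :
    infComp f x ≤ f x := by
  refine sInf_le ⟨f x, ⟨sSup_le ?_, hf hx⟩, rfl⟩
  rintro _ ⟨z, hz, rfl⟩
  exact EReal.coe_le_coe_iff.2 (hz.2.trans (hf.monotone hz.1))

theorem extend_infComp_le_extendIso {f : ℝ ≃o ℝ} {d : EReal} (hd : extendIso f d < d) :
    extend (infComp f) d ≤ extendIso f d := by
  induction d with
  | bot | top => exact absurd hd (lt_irrefl _)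
  | coe d => exact infComp_le_apply f.strictMono (EReal.coe_lt_coe_iff.1 hd)

theorem infComp_le_infComp_of_eq {f : ℝ → ℝ} {x s : ℝ} (hs : infComp f x = s) :
    infComp f x ≤ infComp f s := by
  refine sInf_le_sInf (Set.image_mono fun y hy => ⟨le_trans ?_ hy.1, hy.2⟩)
  refine sSup_le_sSup (Set.image_mono fun z hz => ⟨?_, hz.2⟩)
  exact EReal.coe_le_coe_iff.1 (hs ▸ le_infComp hz.1 hz.2)

theorem extend_infComp_le_extend_infComp (f : ℝ → ℝ) (d : EReal) :
    extend (infComp f) d ≤ extend (infComp f) (extend (infComp f) d) := by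
  induction d with
  | bot | top => exact le_rfl
  | coe d =>
    change infComp f d ≤ extend (infComp f) (infComp f d)
    induction hs : infComp f d with
    | bot | top => exact le_rfl
    | coe s => exact hs.symm.trans_le (infComp_le_infComp_of_eq hs)

/-! ### Walks -/

/-- A possibly empty chain of constraints of `K` from one literal to another; the analogue of
`ExtConstraint.IsPath` for the constraints of a formula. -/
inductive IsWalk (K : Set (Constraint n)) :
    Literal n → Literal n → List (Constraint n) → Prop
  | nil (x : Literal n) : IsWalk K x x []
  | cons {C : Constraint n} (hC : C ∈ K) {y : Literal n} {w : List (Constraint n)}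
      (hw : IsWalk K C.rhs y w) : IsWalk K C.lhs y (C :: w)

/-- The composition `f₁ ∘ ⋯ ∘ f_k` of the functions of a list of constraints. -/
noncomputable def walkFn (w : List (Constraint n)) : ℝ ≃o ℝ :=
  w.foldr (fun C g => g.trans C.fn) (OrderIso.refl ℝ)

theorem walkFn_cons (C : Constraint n) (w : List (Constraint n)) :
    walkFn (C :: w) = (walkFn w).trans C.fn := rfl

theorem walkFn_singleton (C : Constraint n) : walkFn [C] = C.fn := rfl

theorem walkFn_append (v w : List (Constraint n)) :
    walkFn (v ++ w) = (walkFn w).trans (walkFn v) := by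
  induction v with
  | nil => rfl
  | cons C v ih => rw [List.cons_append, walkFn_cons, ih]; rfl

/-- No literal is left twice and no literal is entered twice. For walks, this covers simple paths
as well as simple cycles. -/
structure IsSimple (w : List (Constraint n)) : Prop where
  nodup_lhs : (w.map Constraint.lhs).Nodup
  nodup_rhs : (w.map Constraint.rhs).Nodup

theorem IsSimple.length_le {w : List (Constraint n)} (h : IsSimple w) : w.length ≤ 2 * n := by
  simpa only [List.length_map, Literal.card_eq_two_mul] using h.nodup_lhs.length_le_card

namespace IsWalk

variable {K : Set (Constraint n)} {x y z : Literal n} {u v w : List (Constraint n)}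

theorem append (hv : IsWalk K x y v) (hw : IsWalk K y z w) : IsWalk K x z (v ++ w) := by
  induction hv with
  | nil => exact hw
  | cons hC _ ih => exact .cons hC (ih hw)

theorem eq_of_nil (h : IsWalk K x y []) : x = y := by
  cases h; rfl

theorem exists_of_append (h : IsWalk K x z (v ++ w)) : ∃ y, IsWalk K x y v ∧ IsWalk K y z w := by
  induction v generalizing x with
  | nil => exact ⟨x, .nil x, h⟩
  | cons C v ih =>
    cases h with
    | cons hC h =>
      obtain ⟨y, hv, hw⟩ := ih h
      exact ⟨y, .cons hC hv, hw⟩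

theorem cons_map_rhs (h : IsWalk K x z w) :
    x :: w.map Constraint.rhs = w.map Constraint.lhs ++ [z] := by
  induction h with
  | nil => rfl
  | cons _ _ ih => simp only [List.map_cons, List.cons_append, ← ih]

theorem exists_eq_append_of_mem (h : IsWalk K x z w) (hy : y ∈ x :: w.map Constraint.rhs) :
    ∃ u v, w = u ++ v ∧ IsWalk K x y u ∧ IsWalk K y z v := by
  induction h with
  | nil x =>
    obtain rfl : y = x := by simpa using hy
    exact ⟨[], [], rfl, .nil y, .nil y⟩
  | @cons C hC z w hw ih =>
    rcases List.mem_cons.1 hy with rfl | hy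
    · exact ⟨[], C :: w, rfl, .nil _, .cons hC hw⟩
    · obtain ⟨u, v, rfl, hu, hv⟩ := ih hy
      exact ⟨C :: u, v, rfl, .cons hC hu, hv⟩

theorem start_mem_map_lhs (h : IsWalk K x z w) (hw : w ≠ []) : x ∈ w.map Constraint.lhs := by
  cases h with
  | nil => exact absurd rfl hw
  | cons => exact List.mem_cons_self

theorem end_mem_map_rhs (h : IsWalk K x z w) (hw : w ≠ []) : z ∈ w.map Constraint.rhs := by
  induction h with
  | nil => exact absurd rfl hw
  | @cons C _ z w h ih =>
    rcases eq_or_ne w [] with rfl | hne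
    · exact h.eq_of_nil ▸ List.mem_cons_self
    · exact List.mem_cons_of_mem _ (ih hne)

theorem isSimple_of_nodup (h : IsWalk K x z w) (hn : (x :: w.map Constraint.rhs).Nodup) :
    IsSimple w where
  nodup_lhs := (h.cons_map_rhs ▸ hn).of_append_left
  nodup_rhs := hn.of_cons

theorem isSimple_of_closed (h : IsWalk K x x w) (hn : (w.map Constraint.rhs).Nodup) :
    IsSimple w where
  nodup_lhs := by
    have hperm : (x :: w.map Constraint.rhs).Perm (x :: w.map Constraint.lhs) :=
      h.cons_map_rhs ▸ List.perm_append_singleton _ _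
    exact hperm.cons_inv.nodup_iff.1 hn
  nodup_rhs := hn

theorem ne_of_nodup (h : IsWalk K x z w) (hw : w ≠ [])
    (hn : (x :: w.map Constraint.rhs).Nodup) : x ≠ z := by
  rintro rfl
  exact (List.nodup_cons.1 hn).1 (h.end_mem_map_rhs hw)

theorem nodup_of_append (hu : IsWalk K x y u) (hv : IsWalk K y z v)
    (hn : (x :: (u ++ v).map Constraint.rhs).Nodup) : (y :: v.map Constraint.rhs).Nodup := by
  rw [(hu.append hv).cons_map_rhs, List.map_append, List.append_assoc, ← hv.cons_map_rhs] at hn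
  exact hn.of_append_right

end IsWalk

/-! ### The formulas `H^k(Γ)` -/

/-- The assignment `a` satisfies the constraint `C`. -/
def Constraint.Holds (a : Fin n → ℝ) (C : Constraint n) : Prop :=
  C.lhs.val a ≤ C.fn (C.rhs.val a)

section Iterates

variable {K : Finset (Constraint n)} {C D : Constraint n} {a : Fin n → ℝ}

theorem holds_of_mem_addCompositions (ha : ∀ C ∈ K, C.Holds a) (hC : C ∈ addCompositions K) :
    C.Holds a := by
  classical
  rcases Finset.mem_union.1 hC with hC | hC
  · exact ha C hC
  · obtain ⟨⟨A, B⟩, hAB, rfl⟩ := Finset.mem_image.1 hC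
    obtain ⟨hAB, hmid : A.rhs = B.lhs, -⟩ := Finset.mem_filter.1 hAB
    obtain ⟨hA, hB⟩ := Finset.mem_product.1 hAB
    have hB : A.rhs.val a ≤ B.fn (B.rhs.val a) := hmid ▸ ha B hB
    exact (ha A hA).trans (A.fn.monotone hB)

theorem holds_of_mem_mergeParallel (ha : ∀ C ∈ K, C.Holds a) (hC : C ∈ mergeParallel K) :
    C.Holds a := by
  classical
  obtain ⟨⟨C, hCK⟩, -, rfl⟩ := Finset.mem_image.1 hC
  refine Finset.le_inf' (functionsBetween_nonempty K C hCK) _ fun f hf => ?_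
  obtain ⟨D, hD, rfl⟩ := Finset.mem_image.1 hf
  obtain ⟨hD, hl, hr⟩ := Finset.mem_filter.1 hD
  have hDa := ha D hD
  rwa [Constraint.Holds, hl, hr] at hDa

theorem holds_of_mem_iterate_H {Γ : ContinuousFormula n} (ha : ∀ C ∈ Γ.constraints, C.Holds a)
    (k : ℕ) : ∀ C ∈ (H^[k] Γ).constraints, C.Holds a := by
  induction k with
  | zero => exact ha
  | succ k ih =>
    rw [Function.iterate_succ_apply']
    exact fun C => holds_of_mem_mergeParallel fun D => holds_of_mem_addCompositions ih

theorem exists_mem_mergeParallel_le (hC : C ∈ K) :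
    ∃ D ∈ mergeParallel K, D.lhs = C.lhs ∧ D.rhs = C.rhs ∧ ⇑D.fn ≤ C.fn := by
  classical
  refine ⟨minOfParallel K C hC, ?_, rfl, rfl, fun c => ?_⟩
  · exact Finset.mem_image.2 ⟨⟨C, hC⟩, Finset.mem_attach _ _, rfl⟩
  · refine Finset.inf'_le (fun f : ℝ ≃o ℝ => f c) ?_
    exact Finset.mem_image.2 ⟨C, Finset.mem_filter.2 ⟨hC, rfl, rfl⟩, rfl⟩

theorem eq_of_mem_mergeParallel (hC : C ∈ mergeParallel K) (hD : D ∈ mergeParallel K)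
    (hl : C.lhs = D.lhs) (hr : C.rhs = D.rhs) : C = D := by
  classical
  obtain ⟨⟨⟨x, y, f⟩, hC⟩, -, rfl⟩ := Finset.mem_image.1 hC
  obtain ⟨⟨⟨x', y', g⟩, hD⟩, -, rfl⟩ := Finset.mem_image.1 hD
  obtain rfl : x = x' := hl
  obtain rfl : y = y' := hr
  rfl

theorem comp_mem_addCompositions (hC : C ∈ K) (hD : D ∈ K) (hmid : C.rhs = D.lhs)
    (hl : C.rhs ≠ C.lhs) (hr : C.rhs ≠ D.rhs) :
    (⟨C.lhs, D.rhs, D.fn.trans C.fn⟩ : Constraint n) ∈ addCompositions K := by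
  classical
  refine Finset.mem_union_right _ (Finset.mem_image.2 ⟨(C, D), ?_, rfl⟩)
  exact Finset.mem_filter.2 ⟨Finset.mem_product.2 ⟨hC, hD⟩, hmid, hl, hr⟩

theorem subset_addCompositions (K : Finset (Constraint n)) : K ⊆ addCompositions K := by
  classical
  exact Finset.subset_union_left

end Iterates

/-- Every simple path or simple cycle of length at most `m` in `K` is bounded from below by a single
constraint of `G`. -/
def HasShortcuts (K : Set (Constraint n)) (G : Finset (Constraint n)) (m : ℕ) : Prop :=
  ∀ ⦃x z w⦄, IsWalk K x z w → w ≠ [] → IsSimple w → w.length ≤ m →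
    ∃ C ∈ G, C.lhs = x ∧ C.rhs = z ∧ ⇑C.fn ≤ walkFn w

theorem hasShortcuts_one (K : Finset (Constraint n)) : HasShortcuts K K 1 := by
  intro x z w h hne _ hlen
  cases h with
  | nil => exact absurd rfl hne
  | @cons C hC _ w hw =>
    obtain rfl : w = [] := by simpa using hlen
    exact ⟨C, hC, rfl, hw.eq_of_nil, le_rfl⟩

section Shortcuts

variable {K : Set (Constraint n)} {G : Finset (Constraint n)} {m : ℕ}

theorem hasShortcuts_mergeParallel (h : HasShortcuts K G m) :
    HasShortcuts K (mergeParallel G) m := by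
  intro x z w hw hne hs hlen
  obtain ⟨C, hC, rfl, rfl, hle⟩ := h hw hne hs hlen
  obtain ⟨D, hD, hl, hr, hDC⟩ := exists_mem_mergeParallel_le hC
  exact ⟨D, hD, hl, hr, hDC.trans hle⟩

theorem hasShortcuts_addCompositions (hm : 1 ≤ m) (h : HasShortcuts K G m) :
    HasShortcuts K (addCompositions G) (m * 2) := by
  intro x z w hw hne hs hlen
  rcases le_or_gt w.length m with hshort | hlong
  · obtain ⟨C, hC, hCw⟩ := h hw hne hs hshort
    exact ⟨C, subset_addCompositions G hC, hCw⟩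
  obtain ⟨u, v, rfl, hum, hvm, hune, hvne⟩ : ∃ u v, w = u ++ v ∧ u.length ≤ m ∧ v.length ≤ m ∧
      u ≠ [] ∧ v ≠ [] := by
    refine ⟨w.take m, w.drop m, (List.take_append_drop m w).symm, ?_, ?_, ?_, ?_⟩ <;>
      simp only [← List.length_pos_iff, List.length_take, List.length_drop] <;> omega
  obtain ⟨y, hu, hv⟩ := hw.exists_of_append
  obtain ⟨hl, hr⟩ := hs
  rw [List.map_append] at hl hr
  have hyx : y ≠ x := (List.nodup_append.1 hl).2.2 _ (hu.start_mem_map_lhs hune) _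
    (hv.start_mem_map_lhs hvne) |>.symm
  have hyz : y ≠ z := (List.nodup_append.1 hr).2.2 _ (hu.end_mem_map_rhs hune) _
    (hv.end_mem_map_rhs hvne)
  obtain ⟨C, hC, rfl, rfl, hCu⟩ := h hu hune ⟨hl.of_append_left, hr.of_append_left⟩ hum
  obtain ⟨D, hD, hmid, rfl, hDv⟩ := h hv hvne ⟨hl.of_append_right, hr.of_append_right⟩ hvm
  refine ⟨_, comp_mem_addCompositions hC hD hmid.symm hyx hyz, rfl, rfl, fun c => ?_⟩
  rw [walkFn_append]
  exact (hCu _).trans ((walkFn u).monotone (hDv c))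

end Shortcuts

theorem hasShortcuts_iterate_H (Γ : ContinuousFormula n) (k : ℕ) :
    HasShortcuts Γ.constraints (H^[k] Γ).constraints (2 ^ k) := by
  induction k with
  | zero => exact hasShortcuts_one _
  | succ k ih =>
    rw [Function.iterate_succ_apply', pow_succ]
    exact hasShortcuts_mergeParallel (hasShortcuts_addCompositions Nat.one_le_two_pow ih)

/-! ### Tight paths -/

theorem ceil_logb_add_one (n : ℕ) : ⌈Real.logb 2 (n : ℝ) + 1⌉₊ = Nat.clog 2 n + 1 := by
  have hlog : 0 ≤ Real.logb 2 (n : ℝ) := by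
    rcases n.eq_zero_or_pos with rfl | hn
    · simp only [Nat.cast_zero, Real.logb_zero, le_refl]
    · exact Real.logb_nonneg one_lt_two (Nat.one_le_cast.2 hn)
  rw [Nat.ceil_add_one hlog]
  exact congrArg (· + 1) (Real.natCeil_logb_natCast 2 n)

section PathCons

variable {V : Set (ExtConstraint n)} {x y : Literal n} {e : ExtConstraint n}
  {p : List (ExtConstraint n)}

theorem mem_of_isPath_cons (h : IsPath V x y (e :: p)) : e ∈ V := by
  cases h <;> assumption

theorem lhs_eq_of_isPath_cons (h : IsPath V x y (e :: p)) : e.lhs = x := by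
  cases h <;> rfl

end PathCons

open Classical in
/-- The constraint of `V(Γ)` made from the constraint `C` of `H^⌈log₂ n + 1⌉(Γ)`. -/
noncomputable def Constraint.toExt (C : Constraint n) : ExtConstraint n :=
  ⟨C.lhs, C.rhs,
    if C.lhs = C.rhs then extend (infComp C.fn) else extend (fun c => (C.fn c : EReal))⟩

namespace Constraint

variable {C : Constraint n}

theorem toExt_fn_of_eq (h : C.lhs = C.rhs) : C.toExt.fn = extend (infComp C.fn) := if_pos h

theorem toExt_fn_of_ne (h : C.lhs ≠ C.rhs) : C.toExt.fn = extendIso C.fn := if_neg h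

theorem monotone_toExt_fn (C : Constraint n) : Monotone C.toExt.fn := by
  by_cases h : C.lhs = C.rhs
  · exact toExt_fn_of_eq h ▸ monotone_extend_infComp C.fn
  · exact toExt_fn_of_ne h ▸ monotone_extendIso C.fn

theorem Holds.val_le_toExt_fn {a : Fin n → ℝ} (ha : C.Holds a) :
    (C.lhs.val a : EReal) ≤ C.toExt.fn (C.rhs.val a) := by
  by_cases h : C.lhs = C.rhs
  · rw [toExt_fn_of_eq h, ← h]
    exact le_infComp le_rfl (by rwa [Holds, ← h] at ha)
  · rw [toExt_fn_of_ne h]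
    exact EReal.coe_le_coe_iff.2 ha

end Constraint

namespace ContinuousFormula

/-- The constraints of `H^⌈log₂ n + 1⌉(Γ)`, from which `V(Γ)` is made. -/
noncomputable def core (Γ : ContinuousFormula n) : Finset (Constraint n) :=
  (H^[⌈Real.logb 2 (n : ℝ) + 1⌉₊] Γ).constraints

variable {Γ : ContinuousFormula n} {C D : Constraint n} {a : Fin n → ℝ} {x y z : Literal n}
  {p : List (ExtConstraint n)} {w : List (Constraint n)} {d v s : EReal}

theorem toExt_mem_V (hC : C ∈ Γ.core) : C.toExt ∈ Γ.V := ⟨C, hC, rfl⟩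

theorem eq_of_mem_core (hC : C ∈ Γ.core) (hD : D ∈ Γ.core) (hl : C.lhs = D.lhs)
    (hr : C.rhs = D.rhs) : C = D := by
  rw [core, ceil_logb_add_one, Function.iterate_succ_apply'] at hC hD
  exact eq_of_mem_mergeParallel hC hD hl hr

theorem exists_mem_core_le (hw : IsWalk Γ.constraints x z w) (hne : w ≠ []) (hs : IsSimple w) :
    ∃ C ∈ Γ.core, C.lhs = x ∧ C.rhs = z ∧ ⇑C.fn ≤ walkFn w := by
  refine hasShortcuts_iterate_H Γ _ hw hne hs (hs.length_le.trans ?_)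
  rw [ceil_logb_add_one, pow_succ']
  exact Nat.mul_le_mul_left 2 (Nat.le_pow_clog one_lt_two n)

theorem exists_edge_mem_core_le (hw : IsWalk Γ.constraints x z w) (hne : w ≠ [])
    (hn : (x :: w.map Constraint.rhs).Nodup) :
    ∃ C ∈ Γ.core, C.lhs = x ∧ C.rhs = z ∧ C.lhs ≠ C.rhs ∧ ⇑C.fn ≤ walkFn w := by
  obtain ⟨C, hC, rfl, rfl, hle⟩ := exists_mem_core_le hw hne (hw.isSimple_of_nodup hn)
  exact ⟨C, hC, rfl, rfl, hw.ne_of_nodup hne hn, hle⟩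

theorem monotone_eval (hp : IsPath Γ.V x y p) : Monotone (eval p) := by
  induction hp with
  | single e he =>
    obtain ⟨C, -, rfl⟩ := he
    exact C.monotone_toExt_fn
  | cons e he y p _ ih =>
    obtain ⟨C, -, rfl⟩ := he
    exact C.monotone_toExt_fn.comp ih

theorem val_le_eval (ha : ∀ C ∈ Γ.constraints, C.Holds a) (hp : IsPath Γ.V x y p) :
    (x.val a : EReal) ≤ eval p (y.val a) := by
  have hcore : ∀ C ∈ Γ.core, C.Holds a := holds_of_mem_iterate_H ha _
  induction hp with
  | single e he =>
    obtain ⟨C, hC, rfl⟩ := he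
    exact (hcore C hC).val_le_toExt_fn
  | cons e he y p _ ih =>
    obtain ⟨C, hC, rfl⟩ := he
    exact (hcore C hC).val_le_toExt_fn.trans (C.monotone_toExt_fn ih)

theorem val_le_minTight (ha : ∀ C ∈ Γ.constraints, C.Holds a) (x : Literal n) {c : ℝ}
    (hc : y.val a ≤ c) : (x.val a : EReal) ≤ Γ.minTight x y c := by
  refine le_sInf ?_
  rintro _ ⟨p, hp, -, rfl⟩
  exact (val_le_eval ha hp).trans (monotone_eval hp (EReal.coe_le_coe_iff.2 hc))

/-- `v` is the value at `d` of a path from `y` to `z` in `V(Γ)` that is empty or else tight and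
starts with a loop, so that a constraint that is not a loop can be put in front of it. -/
def IsLoopHeadedValue (Γ : ContinuousFormula n) (y z : Literal n) (d v : EReal) : Prop :=
  (y = z ∧ v = d) ∨ ∃ e p, e.lhs = e.rhs ∧ IsPath Γ.V y z (e :: p) ∧ IsTight (e :: p) ∧
    v = eval (e :: p) d

theorem IsLoopHeadedValue.exists_edge_cons (hC : C ∈ Γ.core) (hne : C.lhs ≠ C.rhs)
    (hv : IsLoopHeadedValue Γ C.rhs z d v) :
    ∃ p, IsPath Γ.V C.lhs z (C.toExt :: p) ∧ IsTight (C.toExt :: p) ∧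
      eval (C.toExt :: p) d = extendIso C.fn v := by
  rcases hv with ⟨rfl, rfl⟩ | ⟨e, p, he, hp, ht, rfl⟩
  · exact ⟨[], .single C.toExt (toExt_mem_V hC), List.isChain_singleton _,
      congrFun (C.toExt_fn_of_ne hne) _⟩
  · refine ⟨e :: p, .cons C.toExt (toExt_mem_V hC) z _ hp, List.isChain_cons_cons.2 ⟨?_, ht⟩,
      congrFun (C.toExt_fn_of_ne hne) _⟩
    exact iff_of_false hne (not_not_intro he)

theorem IsLoopHeadedValue.loop_edge_cons (hC : C ∈ Γ.core) (hloop : C.lhs = C.rhs)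
    (hD : D ∈ Γ.core) (hne : D.lhs ≠ D.rhs) (hCD : C.rhs = D.lhs)
    (hv : IsLoopHeadedValue Γ D.rhs z d v) :
    IsLoopHeadedValue Γ C.lhs z d (extend (infComp C.fn) (extendIso D.fn v)) := by
  obtain ⟨p, hp, ht, hpv⟩ := hv.exists_edge_cons hD hne
  refine Or.inr ⟨C.toExt, D.toExt :: p, hloop, .cons C.toExt (toExt_mem_V hC) z _ ?_,
    List.isChain_cons_cons.2 ⟨iff_of_true hloop hne, ht⟩, ?_⟩
  · rwa [← hCD] at hp
  · rw [← hpv, ← C.toExt_fn_of_eq hloop]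
    rfl

theorem IsLoopHeadedValue.exists_loop_cons_le (hC : C ∈ Γ.core) (hloop : C.lhs = C.rhs)
    (hv : IsLoopHeadedValue Γ C.lhs z d v) :
    ∃ v' ≤ extend (infComp C.fn) v, IsLoopHeadedValue Γ C.lhs z d v' := by
  rcases hv with ⟨rfl, rfl⟩ | ⟨e, p, he, hp, ht, rfl⟩
  · refine ⟨_, le_rfl, Or.inr ⟨C.toExt, [], hloop, ?_, List.isChain_singleton _, ?_⟩⟩
    · have hpath : IsPath Γ.V C.lhs C.rhs [C.toExt] := .single C.toExt (toExt_mem_V hC)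
      rwa [← hloop] at hpath
    · exact (congrFun (C.toExt_fn_of_eq hloop) _).symm
  · refine ⟨_, ?_, Or.inr ⟨e, p, he, hp, ht, rfl⟩⟩
    obtain ⟨D, hD, rfl⟩ := mem_of_isPath_cons hp
    have hDC : D.lhs = C.lhs := lhs_eq_of_isPath_cons hp
    obtain rfl := eq_of_mem_core hD hC hDC (he.symm.trans (hDC.trans hloop))
    change D.toExt.fn (eval p d) ≤ extend (infComp D.fn) (D.toExt.fn (eval p d))
    rw [D.toExt_fn_of_eq hloop]
    exact extend_infComp_le_extend_infComp _ _

/-- `s` is bounded from below by the value at `d` of a simple path of constraints of `Γ` from `x`,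
followed by an empty path or a tight path of `V(Γ)` to `z` that starts with a loop. -/
def IsReducedBound (Γ : ContinuousFormula n) (x z : Literal n) (d s : EReal) : Prop :=
  ∃ y w v, IsWalk Γ.constraints x y w ∧ (x :: w.map Constraint.rhs).Nodup ∧
    IsLoopHeadedValue Γ y z d v ∧ extendIso (walkFn w) v ≤ s

theorem IsReducedBound.mono {t : EReal} (h : IsReducedBound Γ x z d s) (hst : s ≤ t) :
    IsReducedBound Γ x z d t := by
  obtain ⟨y, w, v, hw, hn, hv, hle⟩ := h
  exact ⟨y, w, v, hw, hn, hv, hle.trans hst⟩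

/-- If the cycle does not decrease the value, it is left out. Otherwise the infinite composition of
its shortcut decreases the value at least as much as one turn does. -/
theorem isReducedBound_cycle_append {c : List (Constraint n)} (hc : IsWalk Γ.constraints x x c)
    (hcne : c ≠ []) (hcs : IsSimple c) (hw : IsWalk Γ.constraints x y w)
    (hn : (x :: w.map Constraint.rhs).Nodup) (hv : IsLoopHeadedValue Γ y z d v) :
    IsReducedBound Γ x z d (extendIso (walkFn c) (extendIso (walkFn w) v)) := by
  set s := extendIso (walkFn w) v with hs
  rcases le_or_gt s (extendIso (walkFn c) s) with hcut | hdec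
  · exact ⟨y, w, v, hw, hn, hv, hcut⟩
  obtain ⟨C, hC, rfl, hCr, hCc⟩ := exists_mem_core_le hc hcne hcs
  have hCs : extendIso C.fn s ≤ extendIso (walkFn c) s := extendIso_le_extendIso hCc s
  have hinf : extend (infComp C.fn) s ≤ extendIso (walkFn c) s :=
    (extend_infComp_le_extendIso (hCs.trans_lt hdec)).trans hCs
  suffices hloop : ∃ v' ≤ extend (infComp C.fn) s, IsLoopHeadedValue Γ C.lhs z d v' by
    obtain ⟨v', hle, hv'⟩ := hloop
    refine ⟨C.lhs, [], v', .nil _, List.nodup_singleton _, hv', ?_⟩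
    exact (extendIso_refl v').trans_le (hle.trans hinf)
  rcases eq_or_ne w [] with rfl | hwne
  · obtain rfl := hw.eq_of_nil
    rw [hs, show extendIso (walkFn []) v = v from extendIso_refl v]
    exact hv.exists_loop_cons_le hC hCr.symm
  · obtain ⟨D, hD, hDl, rfl, hDne, hDw⟩ := exists_edge_mem_core_le hw hwne hn
    exact ⟨_, monotone_extend_infComp _ (extendIso_le_extendIso hDw v),
      hv.loop_edge_cons hC hCr.symm hD hDne (hCr.trans hDl.symm)⟩

theorem isReducedBound_walkFn (hw : IsWalk Γ.constraints x z w) (d : EReal) :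
    IsReducedBound Γ x z d (extendIso (walkFn w) d) := by
  induction hw with
  | nil x => exact ⟨x, [], d, .nil x, List.nodup_singleton x, Or.inl ⟨rfl, rfl⟩, le_rfl⟩
  | @cons C hC z w _ ih =>
    obtain ⟨y, u, v, hu, hn, hv, hle⟩ := ih
    have hCle : extendIso (walkFn (C :: u)) v ≤ extendIso (walkFn (C :: w)) d := by
      rw [walkFn_cons, walkFn_cons, extendIso_trans, extendIso_trans]
      exact monotone_extendIso C.fn hle
    by_cases hmem : C.lhs ∈ C.rhs :: u.map Constraint.rhs
    · obtain ⟨c, q, rfl, hc, hq⟩ := hu.exists_eq_append_of_mem hmem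
      have hcycle : IsWalk Γ.constraints C.lhs C.lhs (C :: c) := .cons hC hc
      have hcn : ((C :: c).map Constraint.rhs).Nodup := by
        rw [List.map_append] at hn
        exact hn.of_append_left
      refine (isReducedBound_cycle_append hcycle (List.cons_ne_nil C c)
        (hcycle.isSimple_of_closed hcn) hq (hc.nodup_of_append hq hn) hv).mono ?_
      rwa [← extendIso_trans, ← walkFn_append]
    · exact ⟨y, C :: u, v, .cons hC hu, List.nodup_cons.2 ⟨hmem, hn⟩, hv, hCle⟩

theorem IsReducedBound.le_or_exists_isTight (h : IsReducedBound Γ x z d s) :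
    (x = z ∧ d ≤ s) ∨ ∃ p, IsPath Γ.V x z p ∧ IsTight p ∧ eval p d ≤ s := by
  obtain ⟨y, w, v, hw, hn, hv, hle⟩ := h
  rcases eq_or_ne w [] with rfl | hne
  · obtain rfl := hw.eq_of_nil
    replace hle : v ≤ s := (extendIso_refl v).symm.trans_le hle
    rcases hv with ⟨rfl, rfl⟩ | ⟨e, p, -, hp, ht, rfl⟩
    · exact Or.inl ⟨rfl, hle⟩
    · exact Or.inr ⟨_, hp, ht, hle⟩
  · obtain ⟨C, hC, rfl, rfl, hCne, hCw⟩ := exists_edge_mem_core_le hw hne hn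
    obtain ⟨p, hp, ht, hpv⟩ := hv.exists_edge_cons hC hCne
    exact Or.inr ⟨_, hp, ht, hpv.trans_le ((extendIso_le_extendIso hCw v).trans hle)⟩

theorem le_walkFn_or_minTight_le (hw : IsWalk Γ.constraints x z w) (c : ℝ) :
    (x = z ∧ c ≤ walkFn w c) ∨ Γ.minTight x z c ≤ (walkFn w c : EReal) := by
  rcases (isReducedBound_walkFn hw c).le_or_exists_isTight with ⟨hxz, hle⟩ | ⟨p, hp, ht, hle⟩
  · exact Or.inl ⟨hxz, EReal.coe_le_coe_iff.1 hle⟩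
  · exact Or.inr (sInf_le_of_le ⟨p, hp, ht, rfl⟩ hle)

end ContinuousFormula

/-! ### Closed systems of inequalities -/

section ClosedSystem

variable {L : Type*} [InvolutiveNeg L] {R : L → L → Set (ℝ ≃o ℝ)} {m m' : L → ℝ}
  {x y z : L} {f : ℝ ≃o ℝ} {c : ℝ}

/-- The system of the inequalities `x ≤ f(y)` with `f ∈ R x y`, for real quantities indexed by `L`,
is closed under consequences: it contains the trivial inequalities, the compositions and the
equivalent forms with the negated quantities. -/
structure IsClosedSystem (R : L → L → Set (ℝ ≃o ℝ)) : Prop where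
  refl_mem (x : L) : OrderIso.refl ℝ ∈ R x x
  trans_mem ⦃x y z : L⦄ ⦃f g : ℝ ≃o ℝ⦄ (hf : f ∈ R x y) (hg : g ∈ R y z) : g.trans f ∈ R x z
  dual_mem ⦃x y : L⦄ ⦃f : ℝ ≃o ℝ⦄ (hf : f ∈ R x y) : dual f ∈ R (-y) (-x)

/-- No inequality of `R` fails everywhere on the box of the values `x ≤ m x`. As `x` and `-x` have
opposite values, the lower bound of `x` in this box is `-m (-x)`. -/
def Consistent (R : L → L → Set (ℝ ≃o ℝ)) (m : L → ℝ) : Prop :=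
  ∀ ⦃x y f⦄, f ∈ R x y → -m (-x) ≤ f (m y)

/-- The upper bounds `m` cannot be improved by the inequalities of `R`. -/
def Propagated (R : L → L → Set (ℝ ≃o ℝ)) (m : L → ℝ) : Prop :=
  ∀ ⦃x y f⦄, f ∈ R x y → m x ≤ f (m y)

/-- No value `c` of `x` within the bounds `m` is both too large, because of `x ≤ f(-x)`, and too
small, because of `-x ≤ g(x)`. -/
def ContradictionFree (R : L → L → Set (ℝ ≃o ℝ)) (m : L → ℝ) : Prop :=
  ∀ ⦃x c f g⦄, c ∈ Set.Icc (-m (-x)) (m x) → f ∈ R x (-x) → g ∈ R (-x) x →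
    c ≤ f (-c) ∨ -c ≤ g c

theorem ContradictionFree.anti (h : ContradictionFree R m) (hm : m' ≤ m) :
    ContradictionFree R m' :=
  fun x _ _ _ hc => h ⟨(neg_le_neg (hm (-x))).trans hc.1, hc.2.trans (hm x)⟩

theorem Consistent.neg_apply_neg_le (hR : IsClosedSystem R) (h : Consistent R m) (x : L) :
    -m (-x) ≤ m x :=
  h (hR.refl_mem x)

theorem Propagated.neg_apply_neg_le (hR : IsClosedSystem R) (h : Propagated R m)
    (hf : f ∈ R x y) : -m (-x) ≤ f (-m (-y)) :=
  (le_dual_apply_iff f).1 (h (hR.dual_mem hf))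

theorem Consistent.apply_neg_eq_of_le (hR : IsClosedSystem R) (h : Consistent R m') (hle : m' ≤ m)
    (hx : m (-x) = -m x) : m' (-x) = -m' x := by
  have hx' := h.neg_apply_neg_le hR x
  linarith [hle x, hle (-x)]

/-- The best upper bounds that the inequalities of `R` give for values bounded by `m`. -/
noncomputable def propagate (R : L → L → Set (ℝ ≃o ℝ)) (m : L → ℝ) (x : L) : ℝ :=
  sInf {t | ∃ y, ∃ f ∈ R x y, f (m y) = t}

theorem le_propagate (hR : IsClosedSystem R) (h : ∀ y, ∀ f ∈ R x y, c ≤ f (m y)) :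
    c ≤ propagate R m x := by
  refine le_csInf ⟨m x, x, _, hR.refl_mem x, rfl⟩ ?_
  rintro _ ⟨y, f, hf, rfl⟩
  exact h y f hf

theorem Consistent.propagate_le_apply (h : Consistent R m) (hf : f ∈ R x y) :
    propagate R m x ≤ f (m y) := by
  refine csInf_le ⟨-m (-x), ?_⟩ ⟨y, f, hf, rfl⟩
  rintro _ ⟨z, g, hg, rfl⟩
  exact h hg

theorem Consistent.propagate_le (hR : IsClosedSystem R) (h : Consistent R m) :
    propagate R m ≤ m :=
  fun x => h.propagate_le_apply (hR.refl_mem x)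

theorem Consistent.propagated_propagate (hR : IsClosedSystem R) (h : Consistent R m) :
    Propagated R (propagate R m) := by
  intro x y f hf
  rw [← f.symm_apply_le]
  refine le_propagate hR fun z g hg => f.symm_apply_le.2 ?_
  exact h.propagate_le_apply (hR.trans_mem hf hg)

theorem Consistent.consistent_propagate (hR : IsClosedSystem R) (h : Consistent R m) :
    Consistent R (propagate R m) := by
  intro x y f hf
  suffices hx : -propagate R m (-x) ≤ propagate R m x from
    hx.trans (h.propagated_propagate hR hf)
  refine le_propagate hR fun z g hg => neg_le.1 (le_propagate hR fun w k hk => ?_)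
  have hdual : dual k ∈ R (-w) x := by simpa only [neg_neg] using hR.dual_mem hk
  have hw : -m (- -w) ≤ dual k (g (m z)) := h (hR.trans_mem hdual hg)
  simpa only [neg_neg] using (le_dual_apply_iff k).1 hw

/-- The value `c` of `x` satisfies all inequalities of `R` between `x` and `-x`. -/
structure IsFeasibleAt (R : L → L → Set (ℝ ≃o ℝ)) (x : L) (c : ℝ) : Prop where
  le_apply ⦃f : ℝ ≃o ℝ⦄ (hf : f ∈ R x x) : c ≤ f c
  le_apply_neg ⦃f : ℝ ≃o ℝ⦄ (hf : f ∈ R x (-x)) : c ≤ f (-c)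
  neg_le_apply ⦃f : ℝ ≃o ℝ⦄ (hf : f ∈ R (-x) x) : -c ≤ f c

/-- The values of `x` within the bounds `m` that satisfy the inequalities `x ≤ f(-x)` of `R`. -/
def candidates (R : L → L → Set (ℝ ≃o ℝ)) (m : L → ℝ) (x : L) : Set ℝ :=
  {c | c ∈ Set.Icc (-m (-x)) (m x) ∧ ∀ f ∈ R x (-x), c ≤ f (-c)}

theorem isCompact_candidates (R : L → L → Set (ℝ ≃o ℝ)) (m : L → ℝ) (x : L) :
    IsCompact (candidates R m x) := by
  refine isCompact_Icc.inter_right (t := {c | ∀ f ∈ R x (-x), c ≤ f (-c)}) ?_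
  simp only [Set.ofPred_forall]
  exact isClosed_iInter fun f => isClosed_iInter fun _ =>
    isClosed_le continuous_id (f.continuous.comp continuous_neg)

theorem Consistent.exists_isGreatest_candidates (hR : IsClosedSystem R) (h : Consistent R m)
    (x : L) : ∃ c, IsGreatest (candidates R m x) c := by
  refine (isCompact_candidates R m x).exists_isGreatest ⟨-m (-x), ?_, fun f hf => ?_⟩
  · exact Set.left_mem_Icc.2 (h.neg_apply_neg_le hR x)
  · simpa only [neg_neg] using h hf

theorem exists_apply_neg_lt_of_isGreatest (hc : IsGreatest (candidates R m x) c) {t : ℝ}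
    (hct : c < t) (ht : t ≤ m x) : ∃ f ∈ R x (-x), f (-t) < t := by
  by_contra! hall
  exact hct.not_ge (hc.2 ⟨⟨hc.1.1.1.trans hct.le, ht⟩, hall⟩)

/-- If `x ≤ v(x)` excluded `c`, it would combine with the inequality `x ≤ f(-x)` that excludes a
slightly larger value `t` to the inequality `x ≤ (v ∘ f ∘ ṽ)(-x)`, which excludes `c` as well. -/
theorem Propagated.le_apply_of_isGreatest (hR : IsClosedSystem R) (h : Propagated R m)
    (hc : IsGreatest (candidates R m x) c) {v : ℝ ≃o ℝ} (hv : v ∈ R x x) : c ≤ v c := by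
  by_contra! hlt
  have hcm : c < m x := by
    refine hc.1.1.2.lt_of_ne ?_
    rintro rfl
    exact hlt.not_ge (h hv)
  have hcv : c < v.symm c := v.lt_symm_apply.2 hlt
  obtain ⟨f, hf, hft⟩ :=
    exists_apply_neg_lt_of_isGreatest hc (lt_min hcv hcm) (min_le_right (v.symm c) (m x))
  have hmem : (dual v).trans (f.trans v) ∈ R x (-x) :=
    hR.trans_mem (hR.trans_mem hv hf) (hR.dual_mem hv)
  have hdual : dual v (-c) ≤ -min (v.symm c) (m x) := by
    change -v.symm (- -c) ≤ _
    rw [neg_neg]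
    exact neg_le_neg (min_le_left _ _)
  have hbad : v (f (dual v (-c))) < c :=
    v.lt_symm_apply.1 (((f.monotone hdual).trans_lt hft).trans_le (min_le_left _ _))
  exact hbad.not_ge (hc.1.2 _ hmem)

theorem Consistent.neg_le_apply_of_isGreatest (h : Consistent R m) (hcf : ContradictionFree R m)
    (hc : IsGreatest (candidates R m x) c) {g : ℝ ≃o ℝ} (hg : g ∈ R (-x) x) : -c ≤ g c := by
  rcases hc.1.1.2.eq_or_lt with rfl | hcm
  · simpa only [neg_neg] using h hg
  by_contra! hlt
  obtain ⟨t, htg, hct, htm⟩ : ∃ t, g t < -t ∧ t ∈ Set.Ioc c (m x) :=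
    (((g.continuous.tendsto c).eventually_lt (continuous_neg.tendsto c) hlt).filter_mono
      nhdsWithin_le_nhds |>.and (Ioc_mem_nhdsGT hcm)).exists
  obtain ⟨f, hf, hft⟩ := exists_apply_neg_lt_of_isGreatest hc hct htm
  rcases hcf ⟨hc.1.1.1.trans hct.le, htm⟩ hf hg with hle | hle
  · exact hft.not_ge hle
  · exact htg.not_ge hle

theorem Propagated.isFeasibleAt_of_isGreatest (hR : IsClosedSystem R) (h : Propagated R m)
    (hm : Consistent R m) (hcf : ContradictionFree R m) (hc : IsGreatest (candidates R m x) c) :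
    IsFeasibleAt R x c where
  le_apply _ hf := h.le_apply_of_isGreatest hR hc hf
  le_apply_neg := hc.1.2
  neg_le_apply _ hg := hm.neg_le_apply_of_isGreatest hcf hc hg

theorem IsFeasibleAt.neg_le_apply_neg (hR : IsClosedSystem R) (h : IsFeasibleAt R x c)
    (hf : f ∈ R (-x) (-x)) : -c ≤ f (-c) := by
  have hdual : dual f ∈ R x x := by simpa only [neg_neg] using hR.dual_mem hf
  exact (le_dual_apply_iff f).1 (h.le_apply hdual)

section FixValue

variable [DecidableEq L]

/-- The upper bounds `m` after `x` has been given the value `c`, and hence `-x` the value `-c`. -/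
noncomputable def fixValue (m : L → ℝ) (x : L) (c : ℝ) : L → ℝ :=
  Function.update (Function.update m (-x) (-c)) x c

theorem fixValue_self (m : L → ℝ) (x : L) (c : ℝ) : fixValue m x c x = c :=
  Function.update_self ..

theorem fixValue_neg (hx : -x ≠ x) (m : L → ℝ) (c : ℝ) : fixValue m x c (-x) = -c := by
  rw [fixValue, Function.update_of_ne hx, Function.update_self]

theorem fixValue_of_ne (hy : y ≠ x) (hy' : y ≠ -x) (m : L → ℝ) (c : ℝ) :
    fixValue m x c y = m y := by
  rw [fixValue, Function.update_of_ne hy, Function.update_of_ne hy']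

theorem fixValue_le (hx : -x ≠ x) (hc : c ∈ Set.Icc (-m (-x)) (m x)) : fixValue m x c ≤ m := by
  intro y
  by_cases hy : y = x
  · exact hy ▸ (fixValue_self m x c).trans_le hc.2
  by_cases hy' : y = -x
  · exact hy' ▸ (fixValue_neg hx m c).trans_le (neg_le.1 hc.1)
  exact (fixValue_of_ne hy hy' m c).le

theorem neg_apply_neg_le_fixValue (hx : -x ≠ x) (hm : ∀ y, -m (-y) ≤ m y)
    (hc : c ∈ Set.Icc (-m (-x)) (m x)) (y : L) : -m (-y) ≤ fixValue m x c y := by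
  by_cases hy : y = x
  · exact hy ▸ hc.1.trans_eq (fixValue_self m x c).symm
  by_cases hy' : y = -x
  · rw [hy', fixValue_neg hx, neg_neg]
    exact neg_le_neg hc.2
  exact (hm y).trans_eq (fixValue_of_ne hy hy' m c).symm

theorem Propagated.consistent_fixValue (hR : IsClosedSystem R) (h : Propagated R m)
    (hm : Consistent R m) (hx : -x ≠ x) (hc : c ∈ Set.Icc (-m (-x)) (m x))
    (hfeas : IsFeasibleAt R x c) : Consistent R (fixValue m x c) := by
  have hlow := neg_apply_neg_le_fixValue hx (hm.neg_apply_neg_le hR) hc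
  intro y z f hf
  by_cases hy : y ≠ x ∧ y ≠ -x
  · rw [fixValue_of_ne (mt neg_eq_iff_eq_neg.1 hy.2) (mt neg_inj.1 hy.1)]
    exact (h.neg_apply_neg_le hR hf).trans (f.monotone (hlow z))
  by_cases hz : z ≠ x ∧ z ≠ -x
  · rw [fixValue_of_ne hz.1 hz.2]
    exact (neg_le.1 (by simpa only [neg_neg] using hlow (-y))).trans (h hf)
  obtain rfl | rfl : y = x ∨ y = -x := by tauto
  · obtain rfl | rfl : z = y ∨ z = -y := by tauto
    · simpa only [fixValue_self, fixValue_neg hx, neg_neg] using hfeas.le_apply hf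
    · simpa only [fixValue_self, fixValue_neg hx, neg_neg] using hfeas.le_apply_neg hf
  · obtain rfl | rfl : z = x ∨ z = -x := by tauto
    · simpa only [fixValue_self, neg_neg] using hfeas.neg_le_apply hf
    · simpa only [fixValue_self, fixValue_neg hx, neg_neg] using hfeas.neg_le_apply_neg hR hf

end FixValue

theorem Consistent.exists_le_apply_neg_eq (hR : IsClosedSystem R) (hm : Consistent R m)
    (hcf : ContradictionFree R m) (hx : -x ≠ x) :
    ∃ m' ≤ m, Consistent R m' ∧ m' (-x) = -m' x := by
  classical
  have hprop := hm.propagated_propagate hR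
  have hcons := hm.consistent_propagate hR
  have hle := hm.propagate_le hR
  obtain ⟨c, hc⟩ := hcons.exists_isGreatest_candidates hR x
  have hfeas := hprop.isFeasibleAt_of_isGreatest hR hcons (hcf.anti hle) hc
  refine ⟨fixValue (propagate R m) x c, (fixValue_le hx hc.1.1).trans hle,
    hprop.consistent_fixValue hR hcons hx hc.1.1 hfeas, ?_⟩
  rw [fixValue_neg hx, fixValue_self]

theorem Consistent.exists_le_odd [Finite L] (hR : IsClosedSystem R) (hm : Consistent R m)
    (hcf : ContradictionFree R m) (hL : ∀ x : L, -x ≠ x) :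
    ∃ m' ≤ m, Consistent R m' ∧ Function.Odd m' := by
  classical
  have := Fintype.ofFinite L
  suffices hs : ∀ s : Finset L, ∃ m' ≤ m, Consistent R m' ∧ ∀ x ∈ s, m' (-x) = -m' x by
    obtain ⟨m', hle, hm', hodd⟩ := hs Finset.univ
    exact ⟨m', hle, hm', fun x => hodd x (Finset.mem_univ x)⟩
  intro s
  induction s using Finset.induction_on with
  | empty => exact ⟨m, le_rfl, hm, fun x hx => absurd hx (Finset.notMem_empty x)⟩
  | insert x s _ ih =>
    obtain ⟨m₁, hle₁, hm₁, hodd₁⟩ := ih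
    obtain ⟨m₂, hle₂, hm₂, hx⟩ := hm₁.exists_le_apply_neg_eq hR (hcf.anti hle₁) (hL x)
    refine ⟨m₂, hle₂.trans hle₁, hm₂, (Finset.forall_mem_insert _ _ _).2 ⟨hx, fun y hy => ?_⟩⟩
    exact hm₂.apply_neg_eq_of_le hR hle₂ (hodd₁ y hy)

end ClosedSystem

/-! ### Satisfiability -/

theorem val_eq_of_odd {m : Literal n → ℝ} (hm : Function.Odd m) (x : Literal n) :
    x.val (fun i => m (.pos i)) = m x := by
  cases x with
  | pos i => rfl
  | neg i => exact (hm (.pos i)).symm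

/-- The functions `f` for which a walk of constraints of `K` gives the inequality `x ≤ f(y)`. -/
def implied (K : Set (Constraint n)) (x y : Literal n) : Set (ℝ ≃o ℝ) :=
  walkFn '' {w | IsWalk K x y w}

theorem mem_implied {K : Set (Constraint n)} {C : Constraint n} (hC : C ∈ K) :
    C.fn ∈ implied K C.lhs C.rhs :=
  ⟨[C], .cons hC (.nil C.rhs), walkFn_singleton C⟩

namespace ContinuousFormula

variable {Γ : ContinuousFormula n} {a : Fin n → ℝ}

theorem exists_isWalk_dual (hsymm : Γ.IsSymmetric) {x y : Literal n} {w : List (Constraint n)}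
    (hw : IsWalk Γ.constraints x y w) :
    ∃ w', IsWalk Γ.constraints (-y) (-x) w' ∧ walkFn w' = dual (walkFn w) := by
  induction hw with
  | nil x => exact ⟨[], .nil (-x), dual_refl.symm⟩
  | @cons C hC y w _ ih =>
    obtain ⟨w', hw', hdual⟩ := ih
    let D : Constraint n := ⟨-C.rhs, -C.lhs, dual C.fn⟩
    have hD : IsWalk Γ.constraints (-C.rhs) (-C.lhs) [D] := .cons (hsymm C hC) (.nil _)
    refine ⟨w' ++ [D], hw'.append hD, ?_⟩
    rw [walkFn_append, walkFn_singleton, walkFn_cons, dual_trans, hdual]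

theorem isClosedSystem_implied (hsymm : Γ.IsSymmetric) :
    IsClosedSystem (implied (Γ.constraints : Set (Constraint n))) where
  refl_mem x := ⟨[], .nil x, rfl⟩
  trans_mem := by
    rintro x y z _ _ ⟨v, hv, rfl⟩ ⟨w, hw, rfl⟩
    exact ⟨v ++ w, hv.append hw, walkFn_append v w⟩
  dual_mem := by
    rintro x y _ ⟨w, hw, rfl⟩
    exact exists_isWalk_dual hsymm hw

theorem neg_rangeMax_neg (Γ : ContinuousFormula n) (x : Literal n) :
    -Γ.rangeMax (-x) = Γ.rangeMin x := by
  cases x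
  · exact neg_neg _
  · rfl

theorem rangeMin_le_rangeMax (Γ : ContinuousFormula n) (x : Literal n) :
    Γ.rangeMin x ≤ Γ.rangeMax x := by
  cases x with
  | pos i => exact Γ.lo_le_hi i
  | neg i => exact neg_le_neg (Γ.lo_le_hi i)

theorem val_mem_range (ha : ∀ i, a i ∈ Set.Icc (Γ.lo i) (Γ.hi i)) (x : Literal n) :
    x.val a ∈ Γ.range x := by
  cases x with
  | pos i => exact ha i
  | neg i => exact ⟨neg_le_neg (ha i).2, neg_le_neg (ha i).1⟩

theorem Satisfiable.rangeMin_le_minTight (h : Γ.Satisfiable) (x y : Literal n) :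
    (Γ.rangeMin x : EReal) ≤ Γ.minTight x y (Γ.rangeMax y) := by
  obtain ⟨a, ha, hΓ⟩ := h
  exact (EReal.coe_le_coe_iff.2 (val_mem_range ha x).1).trans
    (val_le_minTight hΓ x (val_mem_range ha y).2)

theorem Satisfiable.le_minTight_or_le_minTight (h : Γ.Satisfiable) (x : Literal n) (c : ℝ) :
    (c : EReal) ≤ Γ.minTight x (-x) (-c) ∨ ((-c : ℝ) : EReal) ≤ Γ.minTight (-x) x c := by
  obtain ⟨a, -, hΓ⟩ := h
  rcases le_total c (x.val a) with hc | hc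
  · have hneg : (-x).val a ≤ -c := (Literal.val_neg a x).trans_le (neg_le_neg hc)
    exact Or.inl ((EReal.coe_le_coe_iff.2 hc).trans (val_le_minTight hΓ x hneg))
  · have hneg : -c ≤ (-x).val a := (neg_le_neg hc).trans_eq (Literal.val_neg a x).symm
    exact Or.inr ((EReal.coe_le_coe_iff.2 hneg).trans (val_le_minTight hΓ (-x) hc))

theorem consistent_rangeMax
    (h : ∀ x y, (Γ.rangeMin x : EReal) ≤ Γ.minTight x y (Γ.rangeMax y)) :
    Consistent (implied (Γ.constraints : Set (Constraint n))) Γ.rangeMax := by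
  rintro x y _ ⟨w, hw, rfl⟩
  rw [neg_rangeMax_neg]
  rcases le_walkFn_or_minTight_le hw (Γ.rangeMax y) with ⟨rfl, hle⟩ | hle
  · exact (Γ.rangeMin_le_rangeMax x).trans hle
  · exact EReal.coe_le_coe_iff.1 ((h x y).trans hle)

theorem minTight_le_of_mem_implied {x y : Literal n} {f : ℝ ≃o ℝ} (hxy : x ≠ y)
    (hf : f ∈ implied (Γ.constraints : Set (Constraint n)) x y) (c : ℝ) :
    Γ.minTight x y c ≤ f c := by
  obtain ⟨w, hw, rfl⟩ := hf
  exact (le_walkFn_or_minTight_le hw c).resolve_left fun h => hxy h.1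

theorem contradictionFree_rangeMax
    (h : ∀ x, ∀ c ∈ Γ.range x,
      Γ.minTight x (-x) (-c) < c → ((-c : ℝ) : EReal) ≤ Γ.minTight (-x) x c) :
    ContradictionFree (implied (Γ.constraints : Set (Constraint n))) Γ.rangeMax := by
  intro x c f g hc hf hg
  rw [neg_rangeMax_neg] at hc
  have hfx := minTight_le_of_mem_implied x.neg_ne_self.symm hf (-c)
  have hgx := minTight_le_of_mem_implied x.neg_ne_self hg c
  refine or_iff_not_imp_left.2 fun hlt => EReal.coe_le_coe_iff.1 ((h x c hc ?_).trans hgx)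
  exact hfx.trans_lt (EReal.coe_lt_coe_iff.2 (not_le.1 hlt))

theorem satisfiable_of_odd_of_consistent {m : Literal n → ℝ} (hodd : Function.Odd m)
    (hle : m ≤ Γ.rangeMax)
    (hm : Consistent (implied (Γ.constraints : Set (Constraint n))) m) : Γ.Satisfiable := by
  refine ⟨fun i => m (.pos i), fun i => ⟨?_, hle (.pos i)⟩, fun C hC => ?_⟩
  · have hneg : -m (.pos i) ≤ -Γ.lo i := (hodd (.pos i)).symm.trans_le (hle (.neg i))
    exact neg_le_neg_iff.1 hneg
  · have hC' := hm (mem_implied hC)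
    rwa [hodd, neg_neg, ← val_eq_of_odd hodd, ← val_eq_of_odd hodd] at hC'

end ContinuousFormula

end ContinuousTwoSAT

theorem mainTheorem4 {n : ℕ} (Γ : ContinuousTwoSAT.ContinuousFormula n)
    (hsymm : Γ.IsSymmetric) :
    Γ.Satisfiable ↔
      ¬ (∃ x y : ContinuousTwoSAT.Literal n,
          Γ.minTight x y (Γ.rangeMax y) < ((Γ.rangeMin x : ℝ) : EReal)) ∧
      ¬ (∃ x : ContinuousTwoSAT.Literal n, ∃ c ∈ Γ.range x,
          Γ.minTight x (-x) (-c) < ((c : ℝ) : EReal) ∧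
          Γ.minTight (-x) x c < ((-c : ℝ) : EReal)) := by
  simp only [not_exists, not_and, not_lt]
  constructor
  · intro hsat
    exact ⟨hsat.rangeMin_le_minTight, fun x c _ hlt =>
      (hsat.le_minTight_or_le_minTight x c).resolve_left hlt.not_ge⟩
  · rintro ⟨hrange, hpair⟩
    have hclosed := ContinuousTwoSAT.ContinuousFormula.isClosedSystem_implied hsymm
    have hcons := ContinuousTwoSAT.ContinuousFormula.consistent_rangeMax hrange
    have hfree := ContinuousTwoSAT.ContinuousFormula.contradictionFree_rangeMax hpair
    obtain ⟨m, hle, hm, hodd⟩ :=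
      hcons.exists_le_odd hclosed hfree ContinuousTwoSAT.Literal.neg_ne_self
    exact ContinuousTwoSAT.ContinuousFormula.satisfiable_of_odd_of_consistent hodd hle hm
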